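/- For $z\in\mathbb{C}$ with $|z|\le 1$, $z\ne 1$, and $v\in\mathbb{C}\setminus\{0,-1,-2,\dots\}$, let $\Phi(z,s,v)$ be the Hurwitz–Lerch zeta function, i.e. the analytic continuation in $s$ of the series $\sum_{k=0}^{\infty} z^k (v+k)^{-s}$ (principal powers), which converges absolutely for $\operatorname{Re} s>1$; write $\Phi'(z,s,v)=\partial\Phi(z,s,v)/\partial s$. Let $n\ge 0$ be an integer and let $x\in\mathbb{C}\setminus\{0,-1,-2,\dots\}$. Then, for $0\le j\le 2n$, the function $s\mapsto\Phi\left(-e^{2i\pi j/(2n+1)},s,x\right)$ is complex differentiable at $s=0$, and $$\prod_{j=0}^{2n}\exp\left(\frac{(-1)^{j-n}\,e^{\frac{i\pi j}{2n+1}}\,\Phi'\left(-e^{\frac{2i\pi j}{2n+1}},0,x\right)}{2n+1}\right)=\frac{1}{\sqrt{2(2n+1)}}\,\frac{\Gamma\left(\frac{n+x}{4n+2}\right)}{\Gamma\left(\frac{3n+x+1}{4n+2}\right)}.$$ If moreover $\operatorname{Re} x>-n$, then $z\mapsto z^{\frac{n+x}{4n+2}-1}(z+1)^{-\frac{3n+x+1}{4n+2}}$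 is integrable on $(0,\infty)$ and $$\prod_{j=0}^{2n}\exp\left(\frac{(-1)^{j-n}\,e^{\frac{i\pi j}{2n+1}}\,\Phi'\left(-e^{\frac{2i\pi j}{2n+1}},0,x\right)}{2n+1}\right)=\frac{1}{\sqrt{2\pi}\,\sqrt{2n+1}}\int_0^\infty\frac{z^{\frac{n+x}{4n+2}-1}}{(z+1)^{\frac{3n+x+1}{4n+2}}}\,dz .$$ -/

import Mathlib

/-- `F` is a holomorphic continuation, in the variable `s`, of the Hurwitz-Lerch series
`∑ k, z ^ k * (v + k) ^ (-s)` (principal powers) from the half-plane `1 < re s` of absolute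
convergence to the half-plane `σ < re s`. -/
structure IsLerchContinuation (z v : ℂ) (σ : ℝ) (F : ℂ → ℂ) : Prop where
  differentiableOn : DifferentiableOn ℂ F {s : ℂ | σ < s.re}
  hasSum : ∀ s : ℂ, σ < s.re → 1 < s.re →
    HasSum (fun k : ℕ => z ^ k * (v + (k : ℂ)) ^ (-s)) (F s)

/-- Two continuations agree wherever both are defined. -/
theorem IsLerchContinuation.eq {z v : ℂ} {σ τ : ℝ} {F G : ℂ → ℂ}
    (hF : IsLerchContinuation z v σ F) (hG : IsLerchContinuation z v τ G)
    {s : ℂ} (hσ : σ < s.re) (hτ : τ < s.re) : F s = G s := by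
  have hopen : ∀ a : ℝ, IsOpen {w : ℂ | a < w.re} := fun a =>
    isOpen_lt continuous_const Complex.continuous_re
  have hF' : AnalyticOnNhd ℂ F {w : ℂ | max σ τ < w.re} :=
    (hF.differentiableOn.mono fun w (hw : max σ τ < w.re) =>
      lt_of_le_of_lt (le_max_left σ τ) hw).analyticOnNhd (hopen _)
  have hG' : AnalyticOnNhd ℂ G {w : ℂ | max σ τ < w.re} :=
    (hG.differentiableOn.mono fun w (hw : max σ τ < w.re) =>
      lt_of_le_of_lt (le_max_right σ τ) hw).analyticOnNhd (hopen _)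
  have hconn : IsPreconnected {w : ℂ | max σ τ < w.re} :=
    (convex_halfSpace_re_gt (max σ τ)).isPreconnected
  obtain ⟨b, hb⟩ : ∃ b : ℝ, max (max σ τ) 1 < b := exists_gt _
  have hb0 : max σ τ < b := lt_of_le_of_lt (le_max_left _ _) hb
  have hev : F =ᶠ[nhds (b : ℂ)] G := by
    filter_upwards [(hopen (max (max σ τ) 1)).mem_nhds (by simpa using hb)] with w hw
    have hw' : max (max σ τ) 1 < w.re := hw
    simp only [max_lt_iff] at hw'
    exact (hF.hasSum w hw'.1.1 hw'.2).unique (hG.hasSum w hw'.1.2 hw'.2)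
  exact hF'.eqOn_of_preconnected_of_eventuallyEq hG' hconn
    (show max σ τ < ((b : ℂ)).re by simpa using hb0) hev (max_lt hσ hτ)

open Classical in
/-- The Hurwitz-Lerch zeta function `Φ(z, s, v)` for `|z| ≤ 1`, `z ≠ 1` and `v ≠ 0, -1, -2, …`:
the value at `s` of the analytic continuation in `s` of `∑ k, z ^ k * (v + k) ^ (-s)`
(and `0` if the series has no continuation to a half-plane containing `s`). -/
noncomputable def lerchPhi (z s v : ℂ) : ℂ :=
  if h : ∃ c : ℂ, ∃ (σ : ℝ) (F : ℂ → ℂ), σ < s.re ∧ IsLerchContinuation z v σ F ∧ F s = c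
  then h.choose else 0

/-- Any continuation computes `Φ`; the value does not depend on the choice made above. -/
theorem IsLerchContinuation.lerchPhi_eq {z v : ℂ} {σ : ℝ} {F : ℂ → ℂ}
    (hF : IsLerchContinuation z v σ F) {s : ℂ} (hs : σ < s.re) : lerchPhi z s v = F s := by
  have h : ∃ c : ℂ, ∃ (σ : ℝ) (F : ℂ → ℂ), σ < s.re ∧ IsLerchContinuation z v σ F ∧ F s = c :=
    ⟨F s, σ, F, hs, hF, rfl⟩
  obtain ⟨τ, G, hτ, hG, hGs⟩ := h.choose_spec
  rw [lerchPhi, dif_pos h, ← hGs]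
  exact hG.eq hF hτ hs

/-- The derivative `Φ'(z, s, v) = ∂Φ(z, s, v)/∂s` in the second argument. -/
noncomputable def lerchPhiDeriv (z s v : ℂ) : ℂ :=
  deriv (fun w : ℂ => lerchPhi z w v) s

/-- The product over `j = 0, …, 2n` of
`exp ((-1)^(j-n) e^{iπj/(2n+1)} Φ'(-e^{2iπj/(2n+1)}, 0, x) / (2n+1))`. -/
noncomputable def lerchExpProduct (n : ℕ) (x : ℂ) : ℂ :=
  ∏ j ∈ Finset.range (2 * n + 1),
    Complex.exp ((-1 : ℂ) ^ ((j : ℤ) - (n : ℤ))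
      * Complex.exp (Complex.I * Real.pi * j / (2 * n + 1))
      * lerchPhiDeriv (-Complex.exp (2 * Complex.I * Real.pi * j / (2 * n + 1))) 0 x
      / (2 * n + 1))

open Complex Filter Topology

/-! The weights and nodes form a roots-of-unity filter. Applied to the series in `k`, the weighted
sum over `j` keeps only `k = n + (2n+1)m`, with sign `(-1)^m`, so `∑ weight_j Φ(node_j, s, x) =
(2n+1)^(-s) Φ(-1, s, y)` with `y = (n+x)/(2n+1)` (`isLerchContinuation_sum_lerchWeight`).
Differentiating at `s = 0` gives `Φ'(-1, 0, y) - log (2n+1) Φ(-1, 0, y)`. There `Φ(-1, 0, y) = 1/2`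
and `exp Φ'(-1, 0, y) = Γ(y/2) / (√2 Γ((y+1)/2))` (`lerchPhi_neg_one_zero_and_exp_deriv`), which is
the Gamma quotient. The integral is a Beta integral with second parameter `1/2`, and `Γ(1/2) = √π`.
Continuation past `s = 0` comes from summing by parts twice: second differences of `(v+k)^(-s)` gain
two powers of `k`. This is done for `1 ≤ re v`, and the shift `v ↦ v + 1` reaches all other `v`. -/

/-! ### Analytic continuation to `-1/2 < re s` by summation by parts. -/

theorem norm_cpow_le_of_one_le_re {w s : ℂ} {a r : ℝ} {R : ℝ} (ha : 1 ≤ a) (hw : a ≤ w.re)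
    (hs : s.re ≤ r) (hr : r ≤ 0) (hR : |s.im| ≤ R) :
    ‖w ^ s‖ ≤ Real.exp (Real.pi * R) * a ^ r := by
  have hw0 : w ≠ 0 := by
    rintro rfl
    simp at hw
    linarith
  have haw : a ≤ ‖w‖ := hw.trans (re_le_norm w)
  rw [norm_cpow_of_ne_zero hw0, div_eq_mul_inv, ← Real.exp_neg, mul_comm]
  have h1 : ‖w‖ ^ s.re ≤ a ^ r :=
    (Real.rpow_le_rpow_of_exponent_le (ha.trans haw) hs).trans
      (Real.rpow_le_rpow_of_nonpos (by linarith) haw hr)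
  have h2 : -(arg w * s.im) ≤ Real.pi * R := by
    refine (neg_le_abs _).trans ?_
    rw [abs_mul]
    exact mul_le_mul (abs_arg_le_pi w) hR (abs_nonneg _) Real.pi_pos.le
  gcongr

/-- A second difference is bounded by the second derivative. -/
theorem norm_second_difference_le {f f' f'' : ℂ → ℂ} {a C : ℝ} {w : ℂ} (hw : a ≤ w.re)
    (hf : ∀ u : ℂ, a ≤ u.re → HasDerivAt f (f' u) u)
    (hf' : ∀ u : ℂ, a ≤ u.re → HasDerivAt f' (f'' u) u)
    (hC : ∀ u : ℂ, a ≤ u.re → ‖f'' u‖ ≤ C) :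
    ‖f (w + 2) - 2 * f (w + 1) + f w‖ ≤ C := by
  have hconv : Convex ℝ {u : ℂ | a ≤ u.re} := convex_halfSpace_re_ge a
  have h1 : ∀ u : ℂ, a ≤ u.re → ‖f' (u + 1) - f' u‖ ≤ C := fun u hu => by
    have := hconv.norm_image_sub_le_of_norm_hasDerivWithin_le
      (fun t ht => (hf' t ht).hasDerivWithinAt) hC hu
      (show u + 1 ∈ {u : ℂ | a ≤ u.re} by simp; linarith)
    simpa using this
  have h2 := hconv.norm_image_sub_le_of_norm_hasDerivWithin_le (f := fun u => f (u + 1) - f u)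
    (f' := fun u => f' (u + 1) - f' u) (x := w) (y := w + 1)
    (fun u hu => by
      have hu' : a ≤ (u + 1).re := by
        have : a ≤ u.re := hu
        simp; linarith
      exact (((hf _ hu').comp_add_const u 1).sub (hf u hu)).hasDerivWithinAt) h1 hw
    (show a ≤ (w + 1).re by simp; linarith)
  have e : w + 1 + 1 = w + 2 := by ring
  simp only [add_sub_cancel_left, norm_one, mul_one, e] at h2
  rwa [show f (w + 2) - 2 * f (w + 1) + f w = f (w + 2) - f (w + 1) - (f (w + 1) - f w) by ring]

/-- The second difference in `k` of the summands `(v + k) ^ (-s)`. -/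
noncomputable def lerchDiff (v : ℂ) (k : ℕ) (s : ℂ) : ℂ :=
  (v + k + 2) ^ (-s) - 2 * (v + k + 1) ^ (-s) + (v + k) ^ (-s)

/-- The second derivative of `u^(-s)` is `s(s+1)u^(-s-2)`, whose exponent has real part below
`-3/2`. Since `1 ≤ re v`, every `u` involved has `re u ≥ k + 1`, clear of the branch cut. -/
theorem norm_lerchDiff_le {v s : ℂ} (hv : 1 ≤ v.re) {R : ℝ} (hs : -(1 / 2) < s.re)
    (hR : ‖s‖ ≤ R) (k : ℕ) :
    ‖lerchDiff v k s‖ ≤ R * (R + 1) * Real.exp (Real.pi * R) * ((k : ℝ) + 1) ^ (-(3 / 2) : ℝ) := by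
  have hR0 : 0 ≤ R := (norm_nonneg s).trans hR
  have hk : (0 : ℝ) ≤ k := k.cast_nonneg
  have hslit : ∀ u : ℂ, (k : ℝ) + 1 ≤ u.re → u ∈ slitPlane := fun u hu => Or.inl (by linarith)
  refine norm_second_difference_le (f := fun u => u ^ (-s)) (f' := fun u => -s * u ^ (-s - 1))
    (f'' := fun u => -s * ((-s - 1) * u ^ (-s - 1 - 1))) (a := (k : ℝ) + 1) (w := v + k)
    (by simp; linarith) (fun u hu => ?_) (fun u hu => ?_) (fun u hu => ?_)
  · simpa using (hasDerivAt_id u).cpow_const (c := -s) (hslit u hu)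
  · simpa using ((hasDerivAt_id u).cpow_const (c := -s - 1) (hslit u hu)).const_mul (-s)
  · have h1 : ‖u ^ (-s - 1 - 1)‖ ≤ Real.exp (Real.pi * R) * ((k : ℝ) + 1) ^ (-(3 / 2) : ℝ) :=
      norm_cpow_le_of_one_le_re (by linarith) hu (by simp; linarith) (by norm_num)
        (by simpa using (abs_im_le_norm s).trans hR)
    have h2 : ‖-s - 1‖ ≤ R + 1 := (norm_sub_le _ _).trans (by simpa using hR)
    rw [norm_mul, norm_mul, norm_neg]
    calc ‖s‖ * (‖-s - 1‖ * ‖u ^ (-s - 1 - 1)‖)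
        ≤ R * ((R + 1) * (Real.exp (Real.pi * R) * ((k : ℝ) + 1) ^ (-(3 / 2) : ℝ))) := by gcongr
      _ = _ := by ring

theorem summable_nat_add_one_rpow {p : ℝ} (hp : p < -1) :
    Summable fun k : ℕ => ((k : ℝ) + 1) ^ p := by
  simpa using (summable_nat_add_iff 1).mpr (Real.summable_nat_rpow.mpr hp)

theorem add_natCast_ne_zero_of_re {v : ℂ} (hv : 1 ≤ v.re) (k : ℕ) : v + k ≠ 0 := fun h => by
  have := congrArg re h
  simp at this
  have hk : (0 : ℝ) ≤ k := k.cast_nonneg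
  linarith

theorem differentiable_cpow_neg {w : ℂ} (hw : w ≠ 0) : Differentiable ℂ fun s : ℂ => w ^ (-s) :=
  fun _ => differentiableAt_id.neg.const_cpow (Or.inl hw)

theorem differentiable_lerchDiff {v : ℂ} (hv : 1 ≤ v.re) (k : ℕ) :
    Differentiable ℂ (lerchDiff v k) := by
  have h := add_natCast_ne_zero_of_re hv
  have h1 : v + k + 1 ≠ 0 := by simpa [add_assoc] using h (k + 1)
  have h2 : v + k + 2 ≠ 0 := by simpa [add_assoc] using h (k + 2)
  exact ((differentiable_cpow_neg h2).sub ((differentiable_cpow_neg h1).const_mul 2)).add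
    (differentiable_cpow_neg (h k))

theorem isOpen_re_gt_inter_ball (R : ℝ) :
    IsOpen ({s : ℂ | -(1 / 2) < s.re} ∩ Metric.ball 0 R) :=
  (isOpen_lt continuous_const continuous_re).inter Metric.isOpen_ball

theorem norm_pow_mul_lerchDiff_le {z v : ℂ} (hz : ‖z‖ ≤ 1) (hv : 1 ≤ v.re) {R : ℝ} (k : ℕ) (s : ℂ)
    (hs : s ∈ {s : ℂ | -(1 / 2) < s.re} ∩ Metric.ball 0 R) :
    ‖z ^ k * lerchDiff v k s‖ ≤
      R * (R + 1) * Real.exp (Real.pi * R) * ((k : ℝ) + 1) ^ (-(3 / 2) : ℝ) := by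
  rw [norm_mul, norm_pow]
  calc ‖z‖ ^ k * ‖lerchDiff v k s‖ ≤ 1 * ‖lerchDiff v k s‖ := by
        gcongr
        exact pow_le_one₀ (norm_nonneg z) hz
    _ ≤ _ := by
        rw [one_mul]
        exact norm_lerchDiff_le hv hs.1 (mem_ball_zero_iff.mp hs.2).le k

theorem summable_lerchDiff_majorant (R : ℝ) : Summable fun k : ℕ =>
    R * (R + 1) * Real.exp (Real.pi * R) * ((k : ℝ) + 1) ^ (-(3 / 2) : ℝ) :=
  (summable_nat_add_one_rpow (by norm_num)).mul_left _

/-- The Hurwitz-Lerch function on `-1/2 < re s` for `1 ≤ re v`, by summation by parts. -/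
noncomputable def lerchByParts (z v s : ℂ) : ℂ :=
  ((1 - 2 * z) * v ^ (-s) + z * (v + 1) ^ (-s) + z ^ 2 * ∑' k : ℕ, z ^ k * lerchDiff v k s)
    / (1 - z) ^ 2

theorem mem_re_gt_inter_ball {s : ℂ} (hs : -(1 / 2) < s.re) :
    s ∈ {s : ℂ | -(1 / 2) < s.re} ∩ Metric.ball 0 (‖s‖ + 1) :=
  ⟨hs, by simp⟩

theorem differentiableAt_tsum_lerchDiff {z v s : ℂ} (hz : ‖z‖ ≤ 1) (hv : 1 ≤ v.re)
    (hs : -(1 / 2) < s.re) :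
    DifferentiableAt ℂ (fun w : ℂ => ∑' k : ℕ, z ^ k * lerchDiff v k w) s :=
  (differentiableOn_tsum_of_summable_norm (summable_lerchDiff_majorant (‖s‖ + 1))
    (fun k => ((differentiable_lerchDiff hv k).const_mul _).differentiableOn)
    (isOpen_re_gt_inter_ball _)
    (norm_pow_mul_lerchDiff_le hz hv)).differentiableAt
    ((isOpen_re_gt_inter_ball _).mem_nhds (mem_re_gt_inter_ball hs))

/-- With `S = ∑ z^k a_k`, shifting indices gives `z² ∑ z^k Δ²a_k = (1-z)² S - (1-2z) a_0 - z a_1`;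
solve for `S`. -/
theorem hasSum_lerchByParts {z v s : ℂ} (hz : ‖z‖ ≤ 1) (hz1 : z ≠ 1) (hv : 1 ≤ v.re)
    (hs : 1 < s.re) :
    HasSum (fun k : ℕ => z ^ k * (v + (k : ℂ)) ^ (-s)) (lerchByParts z v s) := by
  have hsum : Summable fun k : ℕ => z ^ k * (v + (k : ℂ)) ^ (-s) := by
    refine Summable.of_norm_bounded
      ((summable_nat_add_one_rpow (show -s.re < -1 by linarith)).mul_left
        (Real.exp (Real.pi * |s.im|))) fun k => ?_
    have hk : (0 : ℝ) ≤ k := k.cast_nonneg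
    rw [norm_mul, norm_pow]
    calc ‖z‖ ^ k * ‖(v + (k : ℂ)) ^ (-s)‖ ≤ 1 * ‖(v + (k : ℂ)) ^ (-s)‖ := by
          gcongr
          exact pow_le_one₀ (norm_nonneg z) hz
      _ ≤ _ := by
          rw [one_mul]
          exact norm_cpow_le_of_one_le_re (by linarith) (by simp; linarith) (by simp)
            (by linarith) (by simp)
  obtain ⟨S, hS⟩ := hsum
  have h1 := (hasSum_nat_add_iff' 1).mpr hS
  have h2 := (hasSum_nat_add_iff' 2).mpr hS
  have h3 : HasSum (fun k : ℕ => z ^ 2 * (z ^ k * lerchDiff v k s))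
      ((1 - z) ^ 2 * S - (1 - 2 * z) * v ^ (-s) - z * (v + 1) ^ (-s)) := by
    convert! (h2.sub (h1.mul_left (2 * z))).add (hS.mul_left (z ^ 2)) using 1
    · funext k
      simp only [lerchDiff]
      push_cast
      simp only [← add_assoc]
      ring
    · simp [Finset.sum_range_succ]
      ring
  have hz' : (1 - z) ^ 2 ≠ 0 := pow_ne_zero _ (sub_ne_zero.mpr hz1.symm)
  have : lerchByParts z v s = S := by
    rw [lerchByParts, ← tsum_mul_left, h3.tsum_eq, div_eq_iff hz']
    ring
  rwa [this]

theorem isLerchContinuation_lerchByParts {z v : ℂ} (hz : ‖z‖ ≤ 1) (hz1 : z ≠ 1)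
    (hv : 1 ≤ v.re) : IsLerchContinuation z v (-(1 / 2)) (lerchByParts z v) where
  differentiableOn s hs := by
    have h0 : v ≠ 0 := by simpa using add_natCast_ne_zero_of_re hv 0
    have h1 : v + 1 ≠ 0 := by simpa using add_natCast_ne_zero_of_re hv 1
    exact (((((differentiable_cpow_neg h0).const_mul _).add
      ((differentiable_cpow_neg h1).const_mul _)) s).add
      ((differentiableAt_tsum_lerchDiff hz hv hs).const_mul _)).div_const _ |>.differentiableWithinAt
  hasSum _ _ hs := hasSum_lerchByParts hz hz1 hv hs

/-- Splitting off the term `k = 0`; this carries a continuation one unit to the left in `v`. -/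
theorem IsLerchContinuation.of_add_one {z v : ℂ} {σ : ℝ} {F : ℂ → ℂ} (hv : v ≠ 0)
    (hF : IsLerchContinuation z (v + 1) σ F) :
    IsLerchContinuation z v σ fun s => v ^ (-s) + z * F s where
  differentiableOn := (differentiable_cpow_neg hv).differentiableOn.add
    (hF.differentiableOn.const_mul z)
  hasSum s hσ hs := by
    rw [← hasSum_nat_add_iff' 1]
    convert! (hF.hasSum s hσ hs).mul_left z using 1
    · funext k
      push_cast
      rw [show v + ((k : ℂ) + 1) = v + 1 + k by ring]
      ring
    · simp

theorem exists_isLerchContinuation {z v : ℂ} (hz : ‖z‖ ≤ 1) (hz1 : z ≠ 1)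
    (hv : ∀ k : ℕ, v ≠ -(k : ℂ)) : ∃ F, IsLerchContinuation z v (-(1 / 2)) F := by
  obtain ⟨m, hm⟩ := exists_nat_ge (1 - v.re)
  induction m generalizing v with
  | zero => exact ⟨_, isLerchContinuation_lerchByParts hz hz1 (by simp at hm; linarith)⟩
  | succ m ih =>
    obtain ⟨F, hF⟩ := ih (v := v + 1)
      (fun k h => hv (k + 1) (by push_cast; linear_combination h))
      (by push_cast at hm; simp; linarith)
    exact ⟨_, hF.of_add_one (by simpa using hv 0)⟩

theorem IsLerchContinuation.lerchPhi_eventuallyEq {z v : ℂ} {σ : ℝ} {F : ℂ → ℂ}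
    (hF : IsLerchContinuation z v σ F) {s : ℂ} (hs : σ < s.re) :
    (fun w => lerchPhi z w v) =ᶠ[𝓝 s] F := by
  filter_upwards [(isOpen_lt continuous_const continuous_re).mem_nhds hs] with w hw
  exact hF.lerchPhi_eq hw

theorem IsLerchContinuation.differentiableAt {z v : ℂ} {σ : ℝ} {F : ℂ → ℂ}
    (hF : IsLerchContinuation z v σ F) {s : ℂ} (hs : σ < s.re) : DifferentiableAt ℂ F s :=
  hF.differentiableOn.differentiableAt
    ((isOpen_lt continuous_const continuous_re).mem_nhds hs)

theorem IsLerchContinuation.hasDerivAt {z v : ℂ} {σ : ℝ} {F : ℂ → ℂ}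
    (hF : IsLerchContinuation z v σ F) {s : ℂ} (hs : σ < s.re) :
    HasDerivAt F (lerchPhiDeriv z s v) s := by
  rw [lerchPhiDeriv, (hF.lerchPhi_eventuallyEq hs).deriv_eq]
  exact (hF.differentiableAt hs).hasDerivAt

/-! ### Value and derivative of `Φ(-1, s, y)` at `s = 0`. -/

theorem hasDerivAt_cpow_neg_zero {w : ℂ} (hw : w ≠ 0) :
    HasDerivAt (fun s : ℂ => w ^ (-s)) (-log w) 0 := by
  simpa using (hasDerivAt_neg (0 : ℂ)).const_cpow (c := w) (Or.inl hw)

theorem tendsto_log_add_natCast_sub_log (c : ℂ) :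
    Tendsto (fun m : ℕ => log (c + m) - log m) atTop (𝓝 0) := by
  have h0 : Tendsto (fun m : ℕ => 1 + c * ((m : ℂ))⁻¹) atTop (𝓝 1) := by
    simpa using ((tendsto_inv₀_cobounded.comp
      (tendsto_natCast_atTop_cobounded (α := ℂ))).const_mul c).const_add 1
  have h1 := h0.clog one_mem_slitPlane
  rw [log_one] at h1
  refine h1.congr' ?_
  filter_upwards [eventually_ne_atTop 0, h0.eventually_ne one_ne_zero] with m hm hne
  have hm' : (m : ℂ) ≠ 0 := Nat.cast_ne_zero.mpr hm
  have hpos : (0 : ℝ) < m := Nat.cast_pos.mpr (Nat.pos_of_ne_zero hm)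
  have h2 := log_ofReal_mul hpos hne
  rw [ofReal_natCast, natCast_log] at h2
  rw [show c + (m : ℂ) = m * (1 + c * ((m : ℂ))⁻¹) by field_simp; ring, h2]
  ring

theorem sum_neg_one_pow_mul_second_difference (a : ℕ → ℂ) (m : ℕ) :
    ∑ k ∈ Finset.range (2 * m), (-1 : ℂ) ^ k * (a (k + 2) - 2 * a (k + 1) + a k) =
      4 * ∑ k ∈ Finset.range m, (a (2 * k) - a (2 * k + 1)) + a 1 - 3 * a 0
        + 3 * a (2 * m) - a (2 * m + 1) := by
  induction m with
  | zero => simp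
  | succ m ih =>
    rw [Nat.mul_succ, Finset.sum_range_succ, Finset.sum_range_succ, ih, Finset.sum_range_succ,
      pow_succ, pow_mul]
    simp only [add_assoc, Nat.reduceAdd]
    ring

/-- At `s = 0` all powers are `1`, so the second differences vanish and `(3 - 1)/4` remains. -/
theorem lerchPhi_neg_one_zero_of_one_le_re {y : ℂ} (hy : 1 ≤ y.re) :
    lerchPhi (-1) 0 y = 1 / 2 := by
  rw [(isLerchContinuation_lerchByParts (by simp) (by norm_num) hy).lerchPhi_eq (by simp)]
  norm_num [lerchByParts, lerchDiff]

/-- Differentiate the by-parts series termwise, then undo the summation by parts on partial sums;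
the boundary terms are the last two logarithmic expressions. -/
theorem tendsto_lerchPhiDeriv_neg_one {y : ℂ} (hy : 1 ≤ y.re) :
    Tendsto (fun m : ℕ =>
      ∑ k ∈ Finset.range (m + 1), (log (y + (2 * k + 1 : ℕ)) - log (y + (2 * k : ℕ)))
        - log (y + (2 * (m + 1) : ℕ)) / 2
        + (log (y + (2 * (m + 1) + 1 : ℕ)) - log (y + (2 * (m + 1) : ℕ))) / 4)
      atTop (𝓝 (lerchPhiDeriv (-1) 0 y)) := by
  have hne := add_natCast_ne_zero_of_re hy
  have hmem : (0 : ℂ) ∈ {s : ℂ | -(1 / 2) < s.re} ∩ Metric.ball 0 1 := by simp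
  set a : ℕ → ℂ := fun k => -log (y + k) with ha
  have hT := hasSum_deriv_of_summable_norm (F := fun k s => (-1 : ℂ) ^ k * lerchDiff y k s)
    (summable_lerchDiff_majorant 1)
    (fun k => ((differentiable_lerchDiff hy k).const_mul _).differentiableOn)
    (isOpen_re_gt_inter_ball 1) (norm_pow_mul_lerchDiff_le (by simp) hy) hmem
  have hderiv : ∀ k : ℕ, deriv (fun s => (-1 : ℂ) ^ k * lerchDiff y k s) 0 =
      (-1 : ℂ) ^ k * (a (k + 2) - 2 * a (k + 1) + a k) := fun k => by
    have h1 : y + k + 1 ≠ 0 := by simpa [add_assoc] using hne (k + 1)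
    have h2 : y + k + 2 ≠ 0 := by simpa [add_assoc] using hne (k + 2)
    have h := ((((hasDerivAt_cpow_neg_zero h2).sub
      ((hasDerivAt_cpow_neg_zero h1).const_mul 2)).add
      (hasDerivAt_cpow_neg_zero (hne k))).const_mul ((-1 : ℂ) ^ k)).deriv
    simp only [ha]
    push_cast
    simp only [← add_assoc]
    exact h
  simp only [hderiv] at hT
  set T := deriv (fun w : ℂ => ∑' k : ℕ, (-1 : ℂ) ^ k * lerchDiff y k w) 0 with hTdef
  have hD : lerchPhiDeriv (-1) 0 y = (3 * a 0 - a 1 + T) / 4 := by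
    have hF := (isLerchContinuation_lerchByParts (z := -1) (by simp) (by norm_num) hy).hasDerivAt
      (s := 0) (by simp)
    have h0 : y ≠ 0 := by simpa using hne 0
    have h1 : y + 1 ≠ 0 := by simpa using hne 1
    have hG := ((((hasDerivAt_cpow_neg_zero h0).const_mul (1 - 2 * (-1 : ℂ))).add
      ((hasDerivAt_cpow_neg_zero h1).const_mul (-1 : ℂ))).add
      ((differentiableAt_tsum_lerchDiff (z := -1) (s := 0) (by simp) hy
        (by simp)).hasDerivAt.const_mul ((-1 : ℂ) ^ 2))).div_const ((1 - (-1 : ℂ)) ^ 2)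
    rw [hF.unique hG, ← hTdef]
    simp only [ha]
    push_cast
    rw [add_zero]
    ring
  -- Cutting at `2(m+1)` leaves `m + 1` pairs, matching the `m + 1` factors in the denominator of
  -- `GammaSeq _ m`.
  have hlim := (hT.tendsto_sum_nat.comp
    (tendsto_atTop_mono (fun m : ℕ => (by omega : m ≤ 2 * (m + 1))) tendsto_id)).const_add
    (3 * a 0 - a 1) |>.div_const 4
  rw [← hD] at hlim
  refine hlim.congr fun m => ?_
  simp only [Function.comp_apply]
  rw [sum_neg_one_pow_mul_second_difference]
  have : ∀ k : ℕ, a (2 * k) - a (2 * k + 1) = log (y + (2 * k + 1 : ℕ)) - log (y + (2 * k : ℕ)) :=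
    fun k => by simp only [ha]; ring
  simp only [this]
  simp only [ha]
  ring

/-- The products in Euler's limit formula give the quotient; the factorials cancel and the powers of
`m` differ by `m^(1/2)`. -/
theorem exp_sum_log_eq_GammaSeq_div {y : ℂ} (hy : 1 ≤ y.re) {m : ℕ} (hm : m ≠ 0) :
    exp (∑ k ∈ Finset.range (m + 1), (log (y + (2 * k + 1 : ℕ)) - log (y + (2 * k : ℕ)))) =
      GammaSeq (y / 2) m / GammaSeq ((y + 1) / 2) m * exp (log m / 2) := by
  have hne := add_natCast_ne_zero_of_re hy
  have hm' : (m : ℂ) ≠ 0 := Nat.cast_ne_zero.mpr hm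
  rw [exp_sum]
  have h1 : ∀ k : ℕ, exp (log (y + (2 * k + 1 : ℕ)) - log (y + (2 * k : ℕ))) =
      ((y + 1) / 2 + k) / (y / 2 + k) := fun k => by
    have h2 := hne (2 * k)
    rw [exp_sub, exp_log (hne _), exp_log h2]
    have h3 : y / 2 + k ≠ 0 := fun h => h2 (by push_cast; linear_combination 2 * h)
    rw [div_eq_div_iff h2 h3]
    push_cast
    ring
  simp only [h1]
  rw [Finset.prod_div_distrib]
  have hP : ∏ k ∈ Finset.range (m + 1), (y / 2 + (k : ℂ)) ≠ 0 :=
    Finset.prod_ne_zero_iff.mpr fun k _ h => hne (2 * k) (by push_cast; linear_combination 2 * h)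
  have hQ : ∏ k ∈ Finset.range (m + 1), ((y + 1) / 2 + (k : ℂ)) ≠ 0 :=
    Finset.prod_ne_zero_iff.mpr fun k _ h =>
      hne (2 * k + 1) (by push_cast; linear_combination 2 * h)
  have hpow : (m : ℂ) ^ ((y + 1) / 2) = (m : ℂ) ^ (y / 2) * exp (log m / 2) := by
    rw [cpow_def_of_ne_zero hm', cpow_def_of_ne_zero hm', ← exp_add]
    congr 1
    ring
  have hmy : (m : ℂ) ^ (y / 2) ≠ 0 := by simp [cpow_eq_zero_iff, hm']
  have hfac : ((m.factorial : ℕ) : ℂ) ≠ 0 := Nat.cast_ne_zero.mpr m.factorial_ne_zero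
  have hexp := exp_ne_zero (log m / 2)
  rw [GammaSeq, GammaSeq, hpow]
  field_simp

theorem exp_neg_log_div_two {r : ℝ} (hr : 0 < r) : exp (-(Real.log r : ℂ) / 2) = 1 / (√r : ℂ) := by
  rw [Real.sqrt_eq_rpow, Real.rpow_def_of_pos hr, ofReal_exp, one_div, ← exp_neg]
  congr 1
  push_cast
  ring

theorem exp_lerchPhiDeriv_neg_one_of_one_le_re {y : ℂ} (hy : 1 ≤ y.re) :
    exp (lerchPhiDeriv (-1) 0 y) =
      1 / (√2 : ℂ) * (Gamma (y / 2) / Gamma ((y + 1) / 2)) := by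
  have hne := add_natCast_ne_zero_of_re hy
  have hG : Gamma ((y + 1) / 2) ≠ 0 := Gamma_ne_zero_of_re_pos (by simp; linarith)
  refine tendsto_nhds_unique ((continuous_exp.tendsto _).comp (tendsto_lerchPhiDeriv_neg_one hy)) ?_
  have hε := tendsto_log_add_natCast_sub_log ((y + 2) / 2)
  have hε' := tendsto_log_add_natCast_sub_log ((y + 3) / 2)
  -- What is left once `(log m)/2` cancels the growth of `log (y + 2(m+1))/2`; the `log 2` produces
  -- the factor `1/√2`.
  have hexponent : Tendsto (fun m : ℕ => -(Real.log 2 : ℂ) / 2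
      - (log ((y + 2) / 2 + m) - log m) / 2
      + ((log ((y + 3) / 2 + m) - log m) - (log ((y + 2) / 2 + m) - log m)) / 4) atTop
      (𝓝 (-(Real.log 2 : ℂ) / 2)) := by
    simpa using ((tendsto_const_nhds (x := -(Real.log 2 : ℂ) / 2)).sub (hε.div_const 2)).add
      ((hε'.sub hε).div_const 4)
  have hlim := ((continuous_exp.tendsto _).comp hexponent).mul
    ((GammaSeq_tendsto_Gamma (y / 2)).div (GammaSeq_tendsto_Gamma ((y + 1) / 2)) hG)
  rw [exp_neg_log_div_two two_pos] at hlim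
  refine hlim.congr' ?_
  filter_upwards [eventually_ne_atTop 0] with m hm
  simp only [Function.comp_apply, Pi.div_apply]
  have hlog : ∀ c : ℂ, c + m ≠ 0 → log (2 * (c + m)) = Real.log 2 + log (c + m) := fun c hc => by
    simpa using log_ofReal_mul two_pos hc
  have e1 : y + (2 * (m + 1) : ℕ) = 2 * ((y + 2) / 2 + m) := by push_cast; ring
  have e2 : y + (2 * (m + 1) + 1 : ℕ) = 2 * ((y + 3) / 2 + m) := by push_cast; ring
  have n1 : (y + 2) / 2 + m ≠ 0 := fun h => hne (2 * (m + 1)) (by rw [e1, h, mul_zero])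
  have n2 : (y + 3) / 2 + m ≠ 0 := fun h => hne (2 * (m + 1) + 1) (by rw [e2, h, mul_zero])
  conv_rhs => rw [sub_add, exp_sub, exp_sum_log_eq_GammaSeq_div hy hm, mul_div_assoc, ← exp_sub]
  rw [e1, e2, hlog _ n1, hlog _ n2, mul_comm]
  congr 2
  ring

theorem lerchPhi_neg_one_eq_sub {y : ℂ} (hy : ∀ k : ℕ, y ≠ -(k : ℂ)) :
    lerchPhi (-1) 0 y = 1 - lerchPhi (-1) 0 (y + 1) ∧
      lerchPhiDeriv (-1) 0 y = -log y - lerchPhiDeriv (-1) 0 (y + 1) := by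
  have hy0 : y ≠ 0 := by simpa using hy 0
  obtain ⟨F, hF⟩ := exists_isLerchContinuation (z := -1) (v := y + 1) (by simp) (by norm_num)
    (fun k h => hy (k + 1) (by push_cast; linear_combination h))
  have hF' := hF.of_add_one hy0
  have h0 : -(1 / 2) < (0 : ℂ).re := by simp
  constructor
  · rw [hF.lerchPhi_eq h0, hF'.lerchPhi_eq h0]
    simp
    ring
  · rw [(hF'.hasDerivAt h0).unique
      ((hasDerivAt_cpow_neg_zero hy0).add ((hF.hasDerivAt h0).const_mul (-1)))]
    ring

/-- Both sides obey the same recurrence under `y ↦ y + 1`. Stating it for `exp` avoids any choice of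
branch of `log Γ`. -/
theorem lerchPhi_neg_one_zero_and_exp_deriv {y : ℂ} (hy : ∀ k : ℕ, y ≠ -(k : ℂ)) :
    lerchPhi (-1) 0 y = 1 / 2 ∧ exp (lerchPhiDeriv (-1) 0 y) =
      1 / (√2 : ℂ) * (Gamma (y / 2) / Gamma ((y + 1) / 2)) := by
  obtain ⟨m, hm⟩ := exists_nat_ge (1 - y.re)
  induction m generalizing y with
  | zero =>
    have hy1 : 1 ≤ y.re := by simp at hm; linarith
    exact ⟨lerchPhi_neg_one_zero_of_one_le_re hy1, exp_lerchPhiDeriv_neg_one_of_one_le_re hy1⟩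
  | succ m ih =>
    have hy0 : y ≠ 0 := by simpa using hy 0
    obtain ⟨ih0, ih1⟩ := ih (y := y + 1)
      (fun k h => hy (k + 1) (by push_cast; linear_combination h))
      (by push_cast at hm; simp; linarith)
    obtain ⟨r0, r1⟩ := lerchPhi_neg_one_eq_sub hy
    refine ⟨by rw [r0, ih0]; norm_num, ?_⟩
    have hs : (√2 : ℂ) ≠ 0 := by simp
    have hs2 : (√2 : ℂ) ^ 2 = 2 := by
      rw [← ofReal_pow, Real.sq_sqrt (by norm_num)]
      simp
    have g1 : Gamma (y / 2) ≠ 0 := Gamma_ne_zero fun k h =>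
      hy (2 * k) (by push_cast; linear_combination 2 * h)
    have g2 : Gamma ((y + 1) / 2) ≠ 0 := Gamma_ne_zero fun k h =>
      hy (2 * k + 1) (by push_cast; linear_combination 2 * h)
    rw [r1, exp_sub, exp_neg, exp_log hy0, ih1, show (y + 1 + 1) / 2 = y / 2 + 1 by ring,
      Gamma_add_one _ (div_ne_zero hy0 two_ne_zero)]
    field_simp
    rw [hs2]

/-! ### The Beta integral on the half line, via `t = z/(1+z)`. -/

theorem image_div_one_add_Ioi :
    (fun z : ℝ => 1 - (1 + z)⁻¹) '' Set.Ioi 0 = Set.Ioo 0 1 := by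
  ext t
  constructor
  · rintro ⟨z, hz, rfl⟩
    have hz : 0 < z := hz
    have h1 : (1 + z)⁻¹ < 1 := inv_lt_one_of_one_lt₀ (by linarith)
    have h2 : 0 < (1 + z)⁻¹ := by positivity
    exact ⟨by simp only; linarith, by simp only; linarith⟩
  · rintro ⟨h0, h1⟩
    refine ⟨(1 - t)⁻¹ - 1, ?_, ?_⟩
    · have : 1 < (1 - t)⁻¹ := (one_lt_inv₀ (by linarith)).mpr (by linarith)
      simpa using this
    · simp

theorem beta_integrand_comp {u v : ℂ} {z : ℝ} (hz : 0 < z) :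
    |((1 + z) ^ 2)⁻¹| • (((1 - (1 + z)⁻¹ : ℝ) : ℂ) ^ (u - 1) *
      (1 - ((1 - (1 + z)⁻¹ : ℝ) : ℂ)) ^ (v - 1)) = (z : ℂ) ^ (u - 1) / ((z : ℂ) + 1) ^ (u + v) := by
  have hp : 0 < 1 + z := by linarith
  have hc : ((1 + z : ℝ) : ℂ) ≠ 0 := ofReal_ne_zero.mpr hp.ne'
  have e1 : (1 - (1 + z)⁻¹ : ℝ) = z * (1 + z)⁻¹ := by field_simp; ring
  have e2 : (1 - ((1 - (1 + z)⁻¹ : ℝ) : ℂ)) = (((1 + z : ℝ) : ℂ))⁻¹ := by push_cast; ring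
  have e3 : (z : ℂ) + 1 = ((1 + z : ℝ) : ℂ) := by push_cast; ring
  have harg : arg ((1 + z : ℝ) : ℂ) ≠ Real.pi := by
    rw [arg_ofReal_of_nonneg hp.le]
    exact Real.pi_pos.ne
  rw [e2, e1, e3, ofReal_mul, mul_cpow_ofReal_nonneg hz.le (by positivity), ofReal_inv,
    inv_cpow _ _ harg, inv_cpow _ _ harg, abs_of_pos (by positivity), real_smul,
    show u + v = (u - 1) + (v - 1) + (2 : ℕ) by push_cast; ring, cpow_add _ _ hc, cpow_add _ _ hc,
    cpow_natCast]
  push_cast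
  field_simp

/-- The Beta integral on the half line. -/
theorem integrableOn_and_integral_beta_Ioi {u v : ℂ} (hu : 0 < u.re) (hv : 0 < v.re) :
    MeasureTheory.IntegrableOn (fun z : ℝ => (z : ℂ) ^ (u - 1) / ((z : ℂ) + 1) ^ (u + v))
      (Set.Ioi 0) ∧
    ∫ z in Set.Ioi (0 : ℝ), (z : ℂ) ^ (u - 1) / ((z : ℂ) + 1) ^ (u + v) =
      Gamma u * Gamma v / Gamma (u + v) := by
  have hderiv : ∀ z ∈ Set.Ioi (0 : ℝ), HasDerivWithinAt (fun z : ℝ => 1 - (1 + z)⁻¹)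
      (((1 + z) ^ 2)⁻¹) (Set.Ioi 0) z := fun z hz => by
    have hz : 0 < z := hz
    have h := (((hasDerivAt_id z).const_add 1).inv (by simp; linarith)).const_sub 1
    simpa [neg_div] using h.hasDerivWithinAt
  have hinj : Set.InjOn (fun z : ℝ => 1 - (1 + z)⁻¹) (Set.Ioi 0) := fun a _ b _ h => by
    simpa using h
  have hint := betaIntegral_convergent hu hv
  rw [intervalIntegrable_iff_integrableOn_Ioo_of_le zero_le_one, ← image_div_one_add_Ioi,
    MeasureTheory.integrableOn_image_iff_integrableOn_abs_deriv_smul measurableSet_Ioi hderiv hinj]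
    at hint
  refine ⟨hint.congr_fun (fun z hz => beta_integrand_comp hz) measurableSet_Ioi, ?_⟩
  rw [← betaIntegral_eq_Gamma_mul_div u v hu hv, betaIntegral,
    intervalIntegral.integral_of_le zero_le_one, MeasureTheory.integral_Ioc_eq_integral_Ioo,
    ← image_div_one_add_Ioi,
    MeasureTheory.integral_image_eq_integral_abs_deriv_smul measurableSet_Ioi hderiv hinj]
  exact MeasureTheory.setIntegral_congr_fun measurableSet_Ioi fun z hz =>
    (beta_integrand_comp hz).symm

/-! ### The roots-of-unity filter. -/

/-- The weight of `Φ(-e^{2iπj/(2n+1)}, s, x)` in the logarithm of `lerchExpProduct`. -/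
noncomputable def lerchWeight (n j : ℕ) : ℂ :=
  (-1 : ℂ) ^ ((j : ℤ) - (n : ℤ)) * exp (I * Real.pi * j / (2 * n + 1)) / (2 * n + 1)

/-- The first arguments `-e^{2iπj/(2n+1)}` occurring in `lerchExpProduct`. -/
noncomputable def lerchNode (n j : ℕ) : ℂ :=
  -exp (2 * I * Real.pi * j / (2 * n + 1))

theorem two_mul_natCast_add_one_ne_zero (n : ℕ) : (2 * n + 1 : ℂ) ≠ 0 := by
  exact_mod_cast (Nat.succ_ne_zero (2 * n))

theorem lerchNode_eq (n j : ℕ) :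
    lerchNode n j = -exp (2 * Real.pi * I / (2 * n + 1 : ℕ)) ^ j := by
  rw [lerchNode, ← exp_nat_mul]
  congr 2
  push_cast
  ring

theorem norm_lerchNode (n j : ℕ) : ‖lerchNode n j‖ = 1 := by
  rw [lerchNode_eq, norm_neg, norm_pow,
    (isPrimitiveRoot_exp (2 * n + 1) (by omega)).norm'_eq_one (by omega), one_pow]

/-- As `2n+1` is odd, `-1` is not a `(2n+1)`-th root of unity. -/
theorem lerchNode_ne_one (n j : ℕ) : lerchNode n j ≠ 1 := by
  rw [lerchNode_eq]
  intro h
  have h1 := (isPrimitiveRoot_exp (2 * n + 1) (by omega)).pow_eq_one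
  have h2 : exp (2 * Real.pi * I / (2 * n + 1 : ℕ)) ^ j = -1 := by rw [← h, neg_neg]
  have h3 : (-1 : ℂ) ^ (2 * n + 1) = 1 := by rw [← h2, pow_right_comm, h1, one_pow]
  rw [(odd_two_mul_add_one n).neg_one_pow] at h3
  norm_num at h3

/-- With `ζ = e^{2πi/(2n+1)}`, one has `-e^{iπ/(2n+1)} = ζ^(n+1)`, so the half-angle and sign in the
weight merge into a power of `ζ`. -/
theorem lerchWeight_mul_lerchNode_pow (n j k : ℕ) :
    lerchWeight n j * lerchNode n j ^ k = (-1) ^ (n + k) / (2 * n + 1) *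
      (exp (2 * Real.pi * I / (2 * n + 1 : ℕ)) ^ (n + 1 + k)) ^ j := by
  have hN := two_mul_natCast_add_one_ne_zero n
  have h1 : (-1 : ℂ) ^ ((j : ℤ) - (n : ℤ)) = (-1) ^ j * (-1) ^ n := by
    rw [zpow_sub₀ (by norm_num), zpow_natCast, zpow_natCast, div_eq_mul_inv, ← inv_pow]
    norm_num
  have h2 : (-1 : ℂ) ^ j * exp (I * Real.pi * j / (2 * n + 1)) =
      (exp (2 * Real.pi * I / (2 * n + 1 : ℕ)) ^ (n + 1)) ^ j := by
    rw [← exp_pi_mul_I, ← exp_nat_mul, ← exp_nat_mul, ← exp_nat_mul, ← exp_add]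
    congr 1
    push_cast
    field_simp
    ring
  rw [lerchWeight, h1, lerchNode_eq, mul_right_comm, h2, neg_pow]
  ring

theorem sum_lerchWeight_mul_lerchNode_pow (n k : ℕ) :
    ∑ j ∈ Finset.range (2 * n + 1), lerchWeight n j * lerchNode n j ^ k =
      if 2 * n + 1 ∣ n + 1 + k then (-1) ^ (n + k) else 0 := by
  have hN := two_mul_natCast_add_one_ne_zero n
  have hζ := isPrimitiveRoot_exp (2 * n + 1) (by omega)
  simp only [lerchWeight_mul_lerchNode_pow, ← Finset.mul_sum]
  split_ifs with h
  · rw [(hζ.pow_eq_one_iff_dvd _).mpr h]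
    simp [hN]
  · have hne : exp (2 * Real.pi * I / (2 * n + 1 : ℕ)) ^ (n + 1 + k) ≠ 1 :=
      fun he => h ((hζ.pow_eq_one_iff_dvd _).mp he)
    rw [geom_sum_eq hne, ← pow_mul, mul_comm (n + 1 + k), pow_mul, hζ.pow_eq_one, one_pow, sub_self,
      zero_div, mul_zero]

/-- Scaling by a positive real does not change the argument, so principal powers factor. -/
theorem ofReal_mul_cpow_neg {r : ℝ} (hr : 0 < r) {w : ℂ} (hw : w ≠ 0) (s : ℂ) :
    (r : ℂ) ^ s * (r * w) ^ (-s) = w ^ (-s) := by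
  have hr' : (r : ℂ) ≠ 0 := ofReal_ne_zero.mpr hr.ne'
  rw [cpow_def_of_ne_zero hr', cpow_def_of_ne_zero (mul_ne_zero hr' hw), cpow_def_of_ne_zero hw,
    log_ofReal_mul hr hw, ← exp_add, ofReal_log hr.le]
  congr 1
  ring

theorem isLerchContinuation_sum_lerchWeight {n : ℕ} {x : ℂ} (hx : ∀ k : ℕ, x ≠ -(k : ℂ)) {σ : ℝ}
    {F : ℕ → ℂ → ℂ} (hF : ∀ j, IsLerchContinuation (lerchNode n j) x σ (F j)) :
    IsLerchContinuation (-1) ((n + x) / (2 * n + 1)) σ fun s =>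
      (2 * n + 1 : ℂ) ^ s * ∑ j ∈ Finset.range (2 * n + 1), lerchWeight n j * F j s where
  differentiableOn := by
    refine DifferentiableOn.mul ?_ (DifferentiableOn.fun_sum fun j _ =>
      (hF j).differentiableOn.const_mul _)
    exact fun s _ => (differentiableAt_id.const_cpow
      (Or.inl (two_mul_natCast_add_one_ne_zero n))).differentiableWithinAt
  hasSum s hσ hs := by
    have hN := two_mul_natCast_add_one_ne_zero n
    have hsum := hasSum_sum (s := Finset.range (2 * n + 1))
      fun j _ => ((hF j).hasSum s hσ hs).mul_left (lerchWeight n j)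
    simp only [← mul_assoc, ← Finset.sum_mul, sum_lerchWeight_mul_lerchNode_pow] at hsum
    have hinj : Function.Injective fun m : ℕ => n + (2 * n + 1) * m := fun a b h => by
      have h' : (2 * n + 1) * a = (2 * n + 1) * b := Nat.add_left_cancel h
      exact Nat.eq_of_mul_eq_mul_left (by omega) h'
    rw [← hinj.hasSum_iff] at hsum
    · convert! hsum.mul_left ((2 * n + 1 : ℂ) ^ s) using 1
      funext m
      have hdvd : 2 * n + 1 ∣ n + 1 + (n + (2 * n + 1) * m) := ⟨m + 1, by ring⟩
      have hsign : (-1 : ℂ) ^ (n + (n + (2 * n + 1) * m)) = (-1) ^ m := by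
        rw [show n + (n + (2 * n + 1) * m) = 2 * (n + n * m) + m by ring, pow_add, pow_mul]
        simp
      have hbase : x + ((n + (2 * n + 1) * m : ℕ) : ℂ) =
          ((2 * n + 1 : ℝ) : ℂ) * ((n + x) / (2 * n + 1) + m) := by
        push_cast
        linear_combination -div_mul_cancel₀ ((n : ℂ) + x) hN
      have hne : (n + x) / (2 * n + 1) + m ≠ 0 := fun h =>
        hx (n + (2 * n + 1) * m) (by rw [h, mul_zero] at hbase; linear_combination hbase)
      simp only [Function.comp_apply, if_pos hdvd, hsign]
      rw [hbase, mul_left_comm, show (2 * n + 1 : ℂ) = ((2 * n + 1 : ℝ) : ℂ) by push_cast; rfl]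
      rw [ofReal_mul_cpow_neg (by positivity)]
      simpa using hne
    · intro k hk
      rw [if_neg, zero_mul]
      rintro ⟨m, hm⟩
      -- From `n + 1 + k = (2n+1)m` follows `k = n + (2n+1)(m-1)`; `m = 0` is impossible.
      refine hk ⟨m - 1, ?_⟩
      obtain _ | m := m
      · omega
      · simp only [Nat.add_sub_cancel]
        rw [Nat.mul_succ] at hm
        omega

/-! ### Assembly of the product formula and the integral. -/

theorem lerchExpProduct_eq_exp_sum (n : ℕ) (x : ℂ) :
    lerchExpProduct n x = exp (∑ j ∈ Finset.range (2 * n + 1),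
      lerchWeight n j * lerchPhiDeriv (lerchNode n j) 0 x) := by
  rw [lerchExpProduct, exp_sum]
  refine Finset.prod_congr rfl fun j _ => ?_
  rw [lerchWeight, lerchNode]
  congr 1
  ring

theorem sum_lerchWeight_mul_lerchPhiDeriv {n : ℕ} {x : ℂ} (hx : ∀ k : ℕ, x ≠ -(k : ℂ)) :
    ∑ j ∈ Finset.range (2 * n + 1), lerchWeight n j * lerchPhiDeriv (lerchNode n j) 0 x =
      lerchPhiDeriv (-1) 0 ((n + x) / (2 * n + 1)) -
        log (2 * n + 1) * lerchPhi (-1) 0 ((n + x) / (2 * n + 1)) := by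
  have h0 : -(1 / 2) < (0 : ℂ).re := by simp
  choose F hF using fun j =>
    exists_isLerchContinuation (norm_lerchNode n j).le (lerchNode_ne_one n j) hx
  have hG := isLerchContinuation_sum_lerchWeight hx hF
  have hpow : HasDerivAt (fun s : ℂ => (2 * n + 1 : ℂ) ^ s) (log (2 * n + 1)) 0 := by
    simpa using (hasDerivAt_id (0 : ℂ)).const_cpow
      (c := 2 * n + 1) (Or.inl (two_mul_natCast_add_one_ne_zero n))
  have hD := hpow.mul (HasDerivAt.fun_sum (u := Finset.range (2 * n + 1)) fun j _ =>
    ((hF j).hasDerivAt h0).const_mul (lerchWeight n j))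
  rw [(hG.hasDerivAt h0).unique hD, hG.lerchPhi_eq h0]
  simp

theorem lerchExpProduct_eq_Gamma_div {n : ℕ} {x : ℂ} (hx : ∀ k : ℕ, x ≠ -(k : ℂ)) :
    lerchExpProduct n x = 1 / (√(2 * (1 + 2 * n)) : ℂ) *
      (Gamma ((n + x) / (2 + 4 * n)) / Gamma ((1 + 3 * n + x) / (2 + 4 * n))) := by
  have hN := two_mul_natCast_add_one_ne_zero n
  have hy : ∀ k : ℕ, (n + x) / (2 * n + 1) ≠ -(k : ℂ) := fun k h => by
    rw [div_eq_iff hN] at h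
    exact hx (n + (2 * n + 1) * k) (by push_cast; linear_combination h)
  obtain ⟨hval, hexp⟩ := lerchPhi_neg_one_zero_and_exp_deriv hy
  have hlog : log (2 * n + 1 : ℂ) = (Real.log (1 + 2 * n) : ℂ) := by
    rw [ofReal_log (by positivity)]
    push_cast
    rw [add_comm]
  have e : (2 + 4 * n : ℂ) = (2 * n + 1) * 2 := by ring
  rw [lerchExpProduct_eq_exp_sum, sum_lerchWeight_mul_lerchPhiDeriv hx, hval, hlog,
    sub_eq_add_neg, exp_add, hexp,
    show -((Real.log (1 + 2 * n) : ℂ) * (1 / 2)) = -(Real.log (1 + 2 * n) : ℂ) / 2 by ring,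
    exp_neg_log_div_two (by positivity), Real.sqrt_mul (by norm_num), ofReal_mul, e,
    show (n + x) / (2 * n + 1) / 2 = (n + x) / ((2 * n + 1) * 2) by rw [div_div],
    show ((n + x) / (2 * n + 1) + 1) / 2 = (1 + 3 * n + x) / ((2 * n + 1) * 2) by
      rw [div_add_one hN, div_div]; congr 1; ring]
  ring

theorem mainTheorem4 (n : ℕ) (x : ℂ) (hx : ∀ k : ℕ, x ≠ -(k : ℂ)) :
    (∀ j ∈ Finset.range (2 * n + 1),
      DifferentiableAt ℂ
        (fun s : ℂ =>
          lerchPhi (-Complex.exp (2 * Complex.I * Real.pi * j / (2 * n + 1))) s x) 0) ∧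
    lerchExpProduct n x =
      1 / (Real.sqrt (2 * (1 + 2 * n)) : ℂ) *
        (Complex.Gamma ((n + x) / (2 + 4 * n)) / Complex.Gamma ((1 + 3 * n + x) / (2 + 4 * n))) ∧
    (-(n : ℝ) < x.re →
      MeasureTheory.IntegrableOn
        (fun z : ℝ => (z : ℂ) ^ ((n + x) / (4 * n + 2) - 1) /
          ((z : ℂ) + 1) ^ ((3 * n + x + 1) / (4 * n + 2))) (Set.Ioi 0) ∧
      lerchExpProduct n x =
        1 / ((Real.sqrt (2 * Real.pi) : ℂ) * (Real.sqrt (2 * n + 1) : ℂ)) *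
          ∫ z in Set.Ioi (0 : ℝ), (z : ℂ) ^ ((n + x) / (4 * n + 2) - 1) /
            ((z : ℂ) + 1) ^ ((3 * n + x + 1) / (4 * n + 2))) := by
  refine ⟨fun j _ => ?_, lerchExpProduct_eq_Gamma_div hx, fun hre => ?_⟩
  · obtain ⟨F, hF⟩ :=
      exists_isLerchContinuation (norm_lerchNode n j).le (lerchNode_ne_one n j) hx
    have h0 : -(1 / 2) < (0 : ℂ).re := by simp
    exact (hF.differentiableAt h0).congr_of_eventuallyEq (hF.lerchPhi_eventuallyEq h0)
  · have hN := two_mul_natCast_add_one_ne_zero n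
    have e : (4 * n + 2 : ℂ) = ((4 * n + 2 : ℝ) : ℂ) := by push_cast; rfl
    have hN4 : (4 * n + 2 : ℂ) ≠ 0 := by
      rw [show (4 * n + 2 : ℂ) = 2 * (2 * n + 1) by ring]
      exact mul_ne_zero two_ne_zero hN
    have hu : 0 < ((n + x) / (4 * n + 2)).re := by
      rw [e, div_ofReal_re]
      refine div_pos ?_ (by positivity)
      simp
      linarith
    -- The two exponents differ by `1/2`, which is the second Beta parameter.
    have hsum : (3 * n + x + 1) / (4 * n + 2) = (n + x) / (4 * n + 2) + 1 / 2 := by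
      rw [div_add_div _ _ hN4 two_ne_zero, div_eq_div_iff hN4 (mul_ne_zero hN4 two_ne_zero)]
      ring
    obtain ⟨hint, hval⟩ := integrableOn_and_integral_beta_Ioi (v := 1 / 2) hu (by simp)
    rw [hsum]
    refine ⟨hint, ?_⟩
    have hπ : (√Real.pi : ℂ) ≠ 0 := by
      exact ofReal_ne_zero.mpr (Real.sqrt_pos.mpr Real.pi_pos).ne'
    have hG : Gamma (1 / 2) = (√Real.pi : ℂ) := by
      rw [Gamma_one_half_eq, Real.sqrt_eq_rpow, ofReal_cpow Real.pi_pos.le]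
      norm_num
    rw [hval, hG, lerchExpProduct_eq_Gamma_div hx, ← hsum, add_comm (2 : ℂ),
      show (1 + 3 * n + x : ℂ) = 3 * n + x + 1 by ring, Real.sqrt_mul (by norm_num),
      Real.sqrt_mul (by norm_num), add_comm (1 : ℝ)]
    push_cast
    field_simp
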